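/- Let $\Bbbk$ be a field, $S=\Bbbk[x_0,\dots,x_n]$ with its standard grading, and let $I\subseteq S$ be an ideal of projective dimension zero, i.e. $I$ is homogeneous and, for $R=S/I$, there is $m_0>0$ with $\dim_\Bbbk R_i=m_0$ for all sufficiently large $i$. Fix a minimal primary decomposition of $I$, let $I^u$ be the intersection of those of its components whose radical is not $(x_0,\dots,x_n)$, and put $R^u=S/I^u$. For a quotient $A$ of $S$ let $\operatorname{post}(A)$ be the least $i$ with $\dim_\Bbbk A_j=\dim_\Bbbk A_i$ for all $j\ge i$ (where $A_j$ is the image of $S_j$), and put $\mathrm{nz}=\max(\operatorname{post}(R),\operatorname{post}(R^u))$. Let $l\in S_1$ be a linear form whose class is a non-zero divisor on $R^u$, and put $R_*=R/([l]-[1])$, where $[\cdot]$ denotes classes in $R$; write $[[\cdot]]$ for classes in $R_*$. Let $d\ge\mathrm{nz}$ and let $\{[e_1],\dots,[e_m]\}$ be a $\Bbbk$-basis of $R_d$. Then: (a) $m=\dim_\Bbbk R_{\mathrm{nz}}$, and for every $i\ge 0$ the classes $[e_1l^i],\dots,[e_ml^i]$ form a $\Bbbk$-basis of $R_{d+i}$;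 (b) $[[e_1]],\dots,[[e_m]]$ form a $\Bbbk$-basis of $R_*$; (c) there is a linear change of coordinates $y_0,\dots,y_n$ of $S$ (the images of $x_0,\dots,x_n$ under a $\Bbbk$-algebra automorphism of $S$ sending each $x_k$ to a linear form) with $y_0=l$. For every such change of coordinates, every $k\in\{0,\dots,n\}$ and every $i\ge0$, the projective multiplication matrix of $R$ with respect to $y_k$ in degree $d+i$, that is, the matrix $(a_{pq})$ with $[y_k][e_pl^i]=\sum_q a_{pq}[e_ql^{i+1}]$ for all $p$, equals the multiplication matrix of $R_*$ with respect to $y_k$, that is, the matrix $(b_{pq})$ with $[[y_k]]\,[[e_p]]=\sum_q b_{pq}[[e_q]]$ for all $p$. -/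

import Mathlib

namespace ProjMult

open MvPolynomial

attribute [local instance] MvPolynomial.gradedAlgebra

variable {K : Type*} [Field K] {n : ℕ}

/-- The `K`-subspace `(S/J)_d` of the quotient `S/J` of `S = K[x_0, …, x_n]`: the image of the forms
of degree `d`. -/
noncomputable def gradedPiece (J : Ideal (MvPolynomial (Fin (n + 1)) K)) (d : ℕ) :
    Submodule K (MvPolynomial (Fin (n + 1)) K ⧸ J) :=
  (homogeneousSubmodule (Fin (n + 1)) K d).map (Ideal.Quotient.mkₐ K J).toLinearMap

/-- `J` is of projective dimension zero: it is homogeneous, and the Hilbert function of `S/J` is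
eventually equal to a positive constant. -/
def IsProjDimZero (J : Ideal (MvPolynomial (Fin (n + 1)) K)) : Prop :=
  J.IsHomogeneous (homogeneousSubmodule (Fin (n + 1)) K) ∧
    ∃ m : ℕ, 0 < m ∧ ∃ N : ℕ, ∀ i, N ≤ i → Module.finrank K (gradedPiece J i) = m

/-- The postulation number of `S/J`: the least `i` from which on the Hilbert function is
constant. -/
noncomputable def post (J : Ideal (MvPolynomial (Fin (n + 1)) K)) : ℕ :=
  sInf {i | ∀ j, i ≤ j →
    Module.finrank K (gradedPiece J j) = Module.finrank K (gradedPiece J i)}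

/-- `I^u` for an ideal `I` with minimal primary decomposition `t`: the intersection of the
components whose radical is not `(x_0, …, x_n)`. -/
noncomputable def unmixedPart (t : Finset (Ideal (MvPolynomial (Fin (n + 1)) K))) :
    Ideal (MvPolynomial (Fin (n + 1)) K) :=
  ⨅ Q ∈ t, ⨅ _ : Q.radical ≠ idealOfVars (Fin (n + 1)) K, Q

/-- `nz(S/I) = max (post(S/I)) (post(S/I^u))`. -/
noncomputable def nz (I : Ideal (MvPolynomial (Fin (n + 1)) K))
    (t : Finset (Ideal (MvPolynomial (Fin (n + 1)) K))) : ℕ :=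
  max (post I) (post (unmixedPart t))

/-- `R_* = R/([l] - [1])` where `R = S/I`. -/
abbrev AffineRing (I : Ideal (MvPolynomial (Fin (n + 1)) K))
    (l : MvPolynomial (Fin (n + 1)) K) : Type _ :=
  (MvPolynomial (Fin (n + 1)) K ⧸ I) ⧸
    Ideal.span {Ideal.Quotient.mk I l - (1 : MvPolynomial (Fin (n + 1)) K ⧸ I)}

/-- The matrix of a linear map in the row convention: the `i`-th row consists of the coefficients of
the image of the `i`-th basis vector. -/
noncomputable def rowMatrix {V W : Type*} [AddCommGroup V] [Module K V] [AddCommGroup W]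
    [Module K W] {m m' : ℕ} (b : Module.Basis (Fin m) K V) (c : Module.Basis (Fin m') K W)
    (φ : V →ₗ[K] W) : Matrix (Fin m) (Fin m') K :=
  Matrix.of fun i j => c.repr (φ (b i)) j

/-- The multiplication matrix of an element `f` of a finite-dimensional algebra. -/
noncomputable def mulMatrix {A : Type*} [CommRing A] [Algebra K A] {m : ℕ}
    (b : Module.Basis (Fin m) K A) (f : A) : Matrix (Fin m) (Fin m) K :=
  rowMatrix b b (LinearMap.mulLeft K f)

theorem mul_mem_gradedPiece (J : Ideal (MvPolynomial (Fin (n + 1)) K))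
    {f : MvPolynomial (Fin (n + 1)) K} {r : ℕ} (hf : f.IsHomogeneous r) (d : ℕ)
    (a : MvPolynomial (Fin (n + 1)) K ⧸ J) (ha : a ∈ gradedPiece J d) :
    LinearMap.mulLeft K (Ideal.Quotient.mk J f) a ∈ gradedPiece J (d + r) := by
  obtain ⟨g, hg, rfl⟩ := ha
  refine ⟨g * f, IsHomogeneous.mul hg hf, ?_⟩
  simp [mul_comm]

/-- Multiplication by a form `f` of degree `r`, as a map from `(S/J)_d` to `(S/J)_{d+r}`. -/
noncomputable def gradedMul (J : Ideal (MvPolynomial (Fin (n + 1)) K))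
    {f : MvPolynomial (Fin (n + 1)) K} {r : ℕ} (hf : f.IsHomogeneous r) (d : ℕ) :
    gradedPiece J d →ₗ[K] gradedPiece J (d + r) :=
  (LinearMap.mulLeft K (Ideal.Quotient.mk J f)).restrict (mul_mem_gradedPiece J hf d)

/-- The projective multiplication matrix in degree `d` of a form `f` of degree `r`. -/
noncomputable def projMulMatrix (J : Ideal (MvPolynomial (Fin (n + 1)) K))
    {f : MvPolynomial (Fin (n + 1)) K} {r : ℕ} (hf : f.IsHomogeneous r) (d : ℕ) {m m' : ℕ}
    (b : Module.Basis (Fin m) K (gradedPiece J d))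
    (c : Module.Basis (Fin m') K (gradedPiece J (d + r))) : Matrix (Fin m) (Fin m') K :=
  rowMatrix b c (gradedMul J hf d)

/-- A linear change of coordinates of `S`: an automorphism taking the variables to linear forms; the
new coordinates are `y_k = σ x_k`. -/
def IsLinearChange
    (σ : MvPolynomial (Fin (n + 1)) K ≃ₐ[K] MvPolynomial (Fin (n + 1)) K) : Prop :=
  ∀ k, (σ (X k)).IsHomogeneous 1

end ProjMult

/-! An irrelevant component contains a power of `(x_0, …, x_n)`, so `I` and `I^u` have the same
forms in large degrees and both Hilbert functions stabilize at the same `m > 0`. From degree `nz`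
on, the surjection `R_d → R^u_d` is between spaces of dimension `m`, hence bijective: forms in `I^u`
already lie in `I` (`exists_finrank_and_mem_of_nz_le`). Cancelling `l` in `R^u` therefore cancels it
on `R_d`, and equal dimensions make `l^i : R_d → R_{d+i}` bijective.

Homogenizing with `l` shows that the kernel of `R_d → R_*` is `l`-power torsion, hence zero;
surjectivity follows from `[[l]] = 1` (`dehomogenize_bijective`). The maps `R_{d+i} → R_*` match the
bases and commute with multiplication by `y_k`, so the matrices agree. -/

namespace ProjMult

open MvPolynomial

attribute [local instance] MvPolynomial.gradedAlgebra

/-! ### Graded pieces of quotients and the postulation number. -/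

section GradedPiece

variable {K : Type*} [Field K] {n : ℕ} {I J : Ideal (MvPolynomial (Fin (n + 1)) K)}

theorem mk_mem_gradedPiece {f : MvPolynomial (Fin (n + 1)) K} {d : ℕ} (hf : f.IsHomogeneous d) :
    Ideal.Quotient.mk J f ∈ gradedPiece J d :=
  ⟨f, hf, rfl⟩

theorem exists_of_mem_gradedPiece {d : ℕ} {a : MvPolynomial (Fin (n + 1)) K ⧸ J}
    (ha : a ∈ gradedPiece J d) :
    ∃ f : MvPolynomial (Fin (n + 1)) K, f.IsHomogeneous d ∧ Ideal.Quotient.mk J f = a :=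
  ha

/-- The surjection `(S/I)_d → (S/J)_d` for `I ≤ J`. -/
noncomputable def gradedFactor (h : I ≤ J) (d : ℕ) : gradedPiece I d →ₗ[K] gradedPiece J d :=
  (Ideal.Quotient.factorₐ K h).toLinearMap.restrict fun a ha => by
    obtain ⟨f, hf, rfl⟩ := exists_of_mem_gradedPiece ha
    exact ⟨f, hf, rfl⟩

theorem gradedFactor_surjective (h : I ≤ J) (d : ℕ) : Function.Surjective (gradedFactor h d) := by
  rintro ⟨a, ha⟩
  obtain ⟨f, hf, rfl⟩ := exists_of_mem_gradedPiece ha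
  exact ⟨⟨_, mk_mem_gradedPiece hf⟩, Subtype.ext rfl⟩

theorem gradedFactor_injective_iff (h : I ≤ J) (d : ℕ) :
    Function.Injective (gradedFactor h d) ↔
      ∀ f : MvPolynomial (Fin (n + 1)) K, f.IsHomogeneous d → f ∈ J → f ∈ I := by
  rw [injective_iff_map_eq_zero]
  constructor
  · intro H f hf hfJ
    have := H ⟨_, mk_mem_gradedPiece hf⟩ (Subtype.ext (Ideal.Quotient.eq_zero_iff_mem.2 hfJ))
    exact Ideal.Quotient.eq_zero_iff_mem.1 (congrArg Subtype.val this)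
  · rintro H ⟨a, ha⟩ h0
    obtain ⟨f, hf, rfl⟩ := exists_of_mem_gradedPiece ha
    exact Subtype.ext (Ideal.Quotient.eq_zero_iff_mem.2
      (H f hf (Ideal.Quotient.eq_zero_iff_mem.1 (congrArg Subtype.val h0))))

theorem finrank_gradedPiece_of_post_le {m N : ℕ}
    (h : ∀ i, N ≤ i → Module.finrank K (gradedPiece J i) = m) {d : ℕ} (hd : post J ≤ d) :
    Module.finrank K (gradedPiece J d) = m := by
  -- Nonemptiness ensures that the infimum is attained, rather than being the default `sInf ∅ = 0`.
  have hne : {i | ∀ j, i ≤ j → Module.finrank K (gradedPiece J j) =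
      Module.finrank K (gradedPiece J i)}.Nonempty :=
    ⟨N, fun j hj => (h j hj).trans (h N le_rfl).symm⟩
  have hp := Nat.sInf_mem hne
  rw [hp d hd, ← hp (max (sInf _) N) (le_max_left _ _), h _ (le_max_right _ _)]

end GradedPiece

/-! ### Comparison of `I` with `I^u`. -/

section UnmixedPart

variable {K : Type*} [Field K] {n : ℕ} {I : Ideal (MvPolynomial (Fin (n + 1)) K)}
  {t : Finset (Ideal (MvPolynomial (Fin (n + 1)) K))}

theorem le_unmixedPart (ht : t.inf id = I) : I ≤ unmixedPart t := by
  subst ht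
  exact le_iInf₂ fun Q hQ => le_iInf fun _ => Finset.inf_le (f := id) hQ

/-- The unmixed part of `I` and `I` itself have the same forms in large degrees. -/
theorem exists_mem_of_mem_unmixedPart (ht : t.inf id = I) :
    ∃ N, ∀ j, N ≤ j → ∀ f : MvPolynomial (Fin (n + 1)) K, f.IsHomogeneous j →
      f ∈ unmixedPart t → f ∈ I := by
  have hpow : ∀ Q : Ideal (MvPolynomial (Fin (n + 1)) K), ∃ N : ℕ,
      Q.radical = idealOfVars (Fin (n + 1)) K → idealOfVars (Fin (n + 1)) K ^ N ≤ Q := by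
    intro Q
    by_cases hQ : Q.radical = idealOfVars (Fin (n + 1)) K
    · obtain ⟨N, hN⟩ := Ideal.exists_pow_le_of_le_radical_of_fg hQ.ge (idealOfVars_fg _ K)
      exact ⟨N, fun _ => hN⟩
    · exact ⟨0, fun h => absurd h hQ⟩
  choose N hN using hpow
  -- A form of degree at least every `N Q` lies in all the irrelevant components.
  refine ⟨t.sup N, fun j hj f hf hfu => ?_⟩
  rw [← ht, Submodule.mem_finsetInf]
  intro Q hQ
  by_cases hr : Q.radical = idealOfVars (Fin (n + 1)) K
  · refine hN Q hr ((mem_pow_idealOfVars_iff _ _).2 fun x hx => ?_)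
    have hx' : Finsupp.degree x = j := by
      rw [Finsupp.degree_eq_weight_one]
      exact hf (mem_support_iff.1 hx)
    exact hx' ▸ (Finset.le_sup hQ).trans hj
  · simp only [unmixedPart, Submodule.mem_iInf] at hfu
    exact hfu Q hQ hr

/-- From degree `nz` on, the Hilbert functions of `S/I` and `S/I^u` take the same positive value and
the forms in `I` and in `I^u` agree. -/
theorem exists_finrank_and_mem_of_nz_le (hI : IsProjDimZero I) (ht : t.inf id = I) :
    ∃ m, 0 < m ∧ ∀ d, nz I t ≤ d → Module.finrank K (gradedPiece I d) = m ∧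
      ∀ f : MvPolynomial (Fin (n + 1)) K, f.IsHomogeneous d → f ∈ unmixedPart t → f ∈ I := by
  obtain ⟨-, m, hm, N, hN⟩ := hI
  obtain ⟨N', hN'⟩ := exists_mem_of_mem_unmixedPart ht
  have hle := le_unmixedPart ht
  have hu : ∀ i, max N N' ≤ i → Module.finrank K (gradedPiece (unmixedPart t) i) = m := by
    intro i hi
    rw [← hN i (le_of_max_le_left hi)]
    exact (LinearEquiv.ofBijective (gradedFactor hle i)
      ⟨(gradedFactor_injective_iff hle i).2 (hN' i (le_of_max_le_right hi)),
        gradedFactor_surjective hle i⟩).finrank_eq.symm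
  refine ⟨m, hm, fun d hd => ?_⟩
  have h1 := finrank_gradedPiece_of_post_le hN (le_of_max_le_left hd)
  have h2 := finrank_gradedPiece_of_post_le hu (le_of_max_le_right hd)
  refine ⟨h1, (gradedFactor_injective_iff hle d).1 ?_⟩
  -- `finrank` is `0` on infinite-dimensional spaces, so a positive value gives finiteness.
  have := Module.finite_of_finrank_pos (h1 ▸ hm)
  have := Module.finite_of_finrank_pos (h2 ▸ hm)
  exact (LinearMap.injective_iff_surjective_of_finrank_eq_finrank (h1.trans h2.symm)).2
    (gradedFactor_surjective hle d)

theorem mem_of_mul_pow_mem {l : MvPolynomial (Fin (n + 1)) K}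
    (ht : t.inf id = I)
    (hnzd : Ideal.Quotient.mk (unmixedPart t) l ∈
      nonZeroDivisors (MvPolynomial (Fin (n + 1)) K ⧸ unmixedPart t))
    {f : MvPolynomial (Fin (n + 1)) K} (hf : f ∈ unmixedPart t → f ∈ I) {i : ℕ}
    (h : f * l ^ i ∈ I) : f ∈ I := by
  refine hf (Ideal.Quotient.eq_zero_iff_mem.1 ?_)
  refine (mul_right_mem_nonZeroDivisors_eq_zero_iff (pow_mem hnzd i)).1 ?_
  rw [← map_pow, ← map_mul]
  exact Ideal.Quotient.eq_zero_iff_mem.2 (le_unmixedPart ht h)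

theorem ne_zero_of_mem_nonZeroDivisors {l : MvPolynomial (Fin (n + 1)) K}
    (hI : IsProjDimZero I) (ht : t.inf id = I)
    (hnzd : Ideal.Quotient.mk (unmixedPart t) l ∈
      nonZeroDivisors (MvPolynomial (Fin (n + 1)) K ⧸ unmixedPart t)) : l ≠ 0 := by
  rintro rfl
  obtain ⟨m, hm, H⟩ := exists_finrank_and_mem_of_nz_le hI ht
  obtain ⟨h1, h2⟩ := H _ le_rfl
  -- If `l = 0`, then `f * l ∈ I` for every form `f`, and cancelling `l` kills all of `R_nz`.
  have : Subsingleton (gradedPiece I (nz I t)) := by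
    refine subsingleton_of_forall_eq 0 ?_
    rintro ⟨a, ha⟩
    obtain ⟨f, hf, rfl⟩ := exists_of_mem_gradedPiece ha
    refine Subtype.ext (Ideal.Quotient.eq_zero_iff_mem.2 ?_)
    exact mem_of_mul_pow_mem (i := 1) ht hnzd (h2 f hf) (by simp)
  rw [Module.finrank_zero_of_subsingleton] at h1
  omega

end UnmixedPart

/-! ### Homogenization with respect to `l` and the kernel of `R → R_*`. -/

section Homogenization

variable {K : Type*} [Field K] {n : ℕ} {I : Ideal (MvPolynomial (Fin (n + 1)) K)}

/-- Homogenization in degree `D` with respect to `l`: the form `∑_{k ≤ D} p_k l^{D-k}`. -/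
noncomputable def homogenizeWith (l : MvPolynomial (Fin (n + 1)) K) (D : ℕ) :
    MvPolynomial (Fin (n + 1)) K →ₗ[K] MvPolynomial (Fin (n + 1)) K :=
  ∑ k ∈ Finset.range (D + 1), LinearMap.mulRight K (l ^ (D - k)) ∘ₗ homogeneousComponent k

theorem homogenizeWith_of_isHomogeneous (l : MvPolynomial (Fin (n + 1)) K) {D k : ℕ} (hk : k ≤ D)
    {p : MvPolynomial (Fin (n + 1)) K} (hp : p.IsHomogeneous k) :
    homogenizeWith l D p = p * l ^ (D - k) := by
  rw [homogenizeWith, LinearMap.sum_apply, Finset.sum_eq_single k]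
  · simp [homogeneousComponent_of_mem hp]
  · intro j _ hj
    simp [homogeneousComponent_of_mem hp, hj]
  · intro h
    exact absurd (Finset.mem_range.2 (Nat.lt_succ_of_le hk)) h

theorem homogenizeWith_mem (hI : I.IsHomogeneous (homogeneousSubmodule (Fin (n + 1)) K))
    (l : MvPolynomial (Fin (n + 1)) K) (D : ℕ) {p : MvPolynomial (Fin (n + 1)) K} (hp : p ∈ I) :
    homogenizeWith l D p ∈ I := by
  rw [homogenizeWith, LinearMap.sum_apply]
  exact I.sum_mem fun k _ =>
    I.mul_mem_right _ (homogeneousComponent_mem_of_mem hI hp k)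

/-- For a component `h_k`, both `h_k l` and `h_k` homogenize to `h_k l^(D-k)`. The bound is strict
because `h_k l` has degree `k + 1`. -/
theorem homogenizeWith_mul_sub_one {l : MvPolynomial (Fin (n + 1)) K} (hl : l.IsHomogeneous 1)
    {D : ℕ} {h : MvPolynomial (Fin (n + 1)) K} (hD : h.totalDegree < D) :
    homogenizeWith l D (h * (l - 1)) = 0 := by
  conv_lhs => rw [← sum_homogeneousComponent h]
  rw [Finset.sum_mul, map_sum]
  refine Finset.sum_eq_zero fun k hk => ?_
  have hk' : k + 1 ≤ D := by
    have := Finset.mem_range.1 hk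
    omega
  have hh := homogeneousComponent_isHomogeneous k h
  rw [mul_sub, mul_one, map_sub, homogenizeWith_of_isHomogeneous l hk' (hh.mul hl),
    homogenizeWith_of_isHomogeneous l (by omega) hh, mul_assoc, ← pow_succ',
    show D - (k + 1) + 1 = D - k by omega, sub_self]

/-- A form that vanishes in `R/(l - 1)` is annihilated in `R` by a power of `l`. -/
theorem exists_mul_pow_mem_of_mk_eq_zero
    (hI : I.IsHomogeneous (homogeneousSubmodule (Fin (n + 1)) K))
    {l : MvPolynomial (Fin (n + 1)) K} (hl : l.IsHomogeneous 1) {d : ℕ}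
    {f : MvPolynomial (Fin (n + 1)) K} (hf : f.IsHomogeneous d)
    (h : (Ideal.Quotient.mk _ (Ideal.Quotient.mk I f) : AffineRing I l) = 0) :
    ∃ i, f * l ^ i ∈ I := by
  rw [Ideal.Quotient.eq_zero_iff_mem, Ideal.mem_span_singleton'] at h
  obtain ⟨a, ha⟩ := h
  obtain ⟨h, rfl⟩ := Ideal.Quotient.mk_surjective a
  rw [← map_one (Ideal.Quotient.mk I), ← map_sub, ← map_mul, Ideal.Quotient.eq] at ha
  -- This degree exceeds that of `h` and is at least `d`: the multiple of `l - 1` vanishes and only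
  -- `-f l^(D-d)` remains.
  have hmem := homogenizeWith_mem hI l (h.totalDegree + 1 + d) ha
  rw [map_sub, homogenizeWith_mul_sub_one hl (by omega),
    homogenizeWith_of_isHomogeneous l (by omega) hf, zero_sub, neg_mem_iff] at hmem
  exact ⟨_, hmem⟩

/-- Multiplication by powers of `l` does not change classes in `R/(l - 1)`. -/
theorem affineRing_mk_mul_pow (l : MvPolynomial (Fin (n + 1)) K)
    (a : MvPolynomial (Fin (n + 1)) K ⧸ I) (i : ℕ) :
    (Ideal.Quotient.mk _ (a * Ideal.Quotient.mk I l ^ i) : AffineRing I l) =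
      Ideal.Quotient.mk _ a := by
  rw [Ideal.Quotient.eq, Ideal.mem_span_singleton, ← mul_sub_one]
  have h := sub_dvd_pow_sub_pow (Ideal.Quotient.mk I l) 1 i
  rw [one_pow] at h
  exact h.mul_left a

end Homogenization

/-! ### Extending a nonzero linear form to a coordinate system. -/

section LinearChange

variable {K : Type*} [Field K] {n : ℕ}

theorem exists_linearEquiv_apply_eq {V : Type*} [AddCommGroup V] [Module K V]
    [FiniteDimensional K V] {v w : V} (hv : v ≠ 0) (hw : w ≠ 0) : ∃ φ : V ≃ₗ[K] V, φ v = w := by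
  let f := (LinearEquiv.toSpanNonzeroSingleton K V v hv).symm ≪≫ₗ
    LinearEquiv.toSpanNonzeroSingleton K V w hw
  obtain ⟨g, hg⟩ := Submodule.exists_linearEquiv_restrict_eq f
  refine ⟨g, ?_⟩
  have h := hg (LinearEquiv.toSpanNonzeroSingleton K V v hv 1)
  simp only [f, LinearEquiv.trans_apply, LinearEquiv.symm_apply_apply] at h
  simpa using h.symm

/-- The linear form with given coefficients. -/
noncomputable def linearForm (K : Type*) [Field K] (n : ℕ) :
    (Fin (n + 1) → K) →ₗ[K] MvPolynomial (Fin (n + 1)) K :=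
  Fintype.linearCombination K X

theorem linearForm_single (k : Fin (n + 1)) :
    linearForm K n (Pi.single k 1) = X k := by
  simp [linearForm, Fintype.linearCombination_apply_single]

theorem range_linearForm :
    LinearMap.range (linearForm K n) = homogeneousSubmodule (Fin (n + 1)) K 1 := by
  rw [homogeneousSubmodule_one_eq_span_X, linearForm, Fintype.range_linearCombination]

/-- The endomorphism of `S` induced by a linear map on linear forms. -/
noncomputable def linearSubst (φ : (Fin (n + 1) → K) →ₗ[K] (Fin (n + 1) → K)) :
    MvPolynomial (Fin (n + 1)) K →ₐ[K] MvPolynomial (Fin (n + 1)) K :=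
  aeval fun k => linearForm K n (φ (Pi.single k 1))

theorem linearSubst_linearForm (φ : (Fin (n + 1) → K) →ₗ[K] (Fin (n + 1) → K))
    (v : Fin (n + 1) → K) : linearSubst φ (linearForm K n v) = linearForm K n (φ v) := by
  have : (linearSubst φ).toLinearMap ∘ₗ linearForm K n = linearForm K n ∘ₗ φ := by
    refine LinearMap.pi_ext' fun k => LinearMap.ext_ring ?_
    simp [linearForm_single, linearSubst]
  exact LinearMap.congr_fun this v

theorem linearSubst_comp_eq_id {φ ψ : (Fin (n + 1) → K) →ₗ[K] (Fin (n + 1) → K)}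
    (h : ∀ v, φ (ψ v) = v) : (linearSubst φ).comp (linearSubst ψ) = AlgHom.id K _ := by
  refine MvPolynomial.algHom_ext fun k => ?_
  rw [AlgHom.comp_apply, ← linearForm_single, linearSubst_linearForm, linearSubst_linearForm, h,
    AlgHom.id_apply]

theorem exists_isLinearChange {l : MvPolynomial (Fin (n + 1)) K} (hl : l.IsHomogeneous 1)
    (h0 : l ≠ 0) :
    ∃ σ : MvPolynomial (Fin (n + 1)) K ≃ₐ[K] MvPolynomial (Fin (n + 1)) K,
      IsLinearChange σ ∧ σ (X 0) = l := by
  obtain ⟨a, rfl⟩ : l ∈ LinearMap.range (linearForm K n) := range_linearForm.ge hl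
  have ha : a ≠ 0 := by
    rintro rfl
    exact h0 (map_zero _)
  obtain ⟨φ, hφ⟩ := exists_linearEquiv_apply_eq (K := K) (v := Pi.single (0 : Fin (n + 1)) 1)
    (by simp) ha
  refine ⟨AlgEquiv.ofAlgHom (linearSubst φ.toLinearMap) (linearSubst φ.symm.toLinearMap)
    (linearSubst_comp_eq_id (by simp)) (linearSubst_comp_eq_id (by simp)), fun k => ?_, ?_⟩
  · rw [AlgEquiv.ofAlgHom_apply, ← linearForm_single, linearSubst_linearForm]
    exact range_linearForm.le (LinearMap.mem_range_self _ _)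
  · rw [AlgEquiv.ofAlgHom_apply, ← linearForm_single, linearSubst_linearForm,
      LinearEquiv.coe_coe, hφ]

end LinearChange

/-! ### Transport of bases and matrices. -/

section Bases

variable {K : Type*} [Field K] {n : ℕ} {I : Ideal (MvPolynomial (Fin (n + 1)) K)}

/-- Multiplication by `l ^ i`, as a map from `R_d` to `R_{d+i}`. -/
noncomputable def gradedMulPow (I : Ideal (MvPolynomial (Fin (n + 1)) K))
    {l : MvPolynomial (Fin (n + 1)) K} (hl : l.IsHomogeneous 1) (d i : ℕ) :
    gradedPiece I d →ₗ[K] gradedPiece I (d + i) :=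
  gradedMul I (show (l ^ i).IsHomogeneous i by simpa using hl.pow i) d

theorem coe_gradedMulPow {l : MvPolynomial (Fin (n + 1)) K} (hl : l.IsHomogeneous 1) (d i : ℕ)
    (a : gradedPiece I d) :
    (gradedMulPow I hl d i a : MvPolynomial (Fin (n + 1)) K ⧸ I) =
      a * Ideal.Quotient.mk I l ^ i := by
  rw [mul_comm, ← map_pow]
  rfl

theorem gradedMulPow_bijective {l : MvPolynomial (Fin (n + 1)) K} (hl : l.IsHomogeneous 1)
    {d i : ℕ}
    (hinj : ∀ f : MvPolynomial (Fin (n + 1)) K, f.IsHomogeneous d → f * l ^ i ∈ I → f ∈ I)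
    (hpos : 0 < Module.finrank K (gradedPiece I d))
    (hrank : Module.finrank K (gradedPiece I (d + i)) = Module.finrank K (gradedPiece I d)) :
    Function.Bijective (gradedMulPow I hl d i) := by
  have hi : Function.Injective (gradedMulPow I hl d i) := by
    rw [injective_iff_map_eq_zero]
    rintro ⟨a, ha⟩ h
    obtain ⟨f, hf, rfl⟩ := exists_of_mem_gradedPiece ha
    have h' := congrArg Subtype.val h
    rw [coe_gradedMulPow, ← map_pow, ← map_mul] at h'
    exact Subtype.ext (Ideal.Quotient.eq_zero_iff_mem.2
      (hinj f hf (Ideal.Quotient.eq_zero_iff_mem.1 h')))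
  have := Module.finite_of_finrank_pos hpos
  have := Module.finite_of_finrank_pos (hrank.symm ▸ hpos)
  exact ⟨hi, (LinearMap.injective_iff_surjective_of_finrank_eq_finrank hrank.symm).1 hi⟩

/-- The map from `R_d` to `R/(l - 1)`. -/
noncomputable def dehomogenize (I : Ideal (MvPolynomial (Fin (n + 1)) K))
    (l : MvPolynomial (Fin (n + 1)) K) (d : ℕ) : gradedPiece I d →ₗ[K] AffineRing I l :=
  (Ideal.Quotient.mkₐ K _).toLinearMap ∘ₗ (gradedPiece I d).subtype

theorem dehomogenize_apply (l : MvPolynomial (Fin (n + 1)) K) (d : ℕ) (a : gradedPiece I d) :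
    dehomogenize I l d a = Ideal.Quotient.mk _ (a : MvPolynomial (Fin (n + 1)) K ⧸ I) :=
  rfl

/-- Kernel elements are `l`-power torsion, excluded by `hinj`. As `[[l]] = 1`, a form of degree
below `d` can be multiplied up to degree `d`, and one above `d` divided down by `hsurj`. -/
theorem dehomogenize_bijective (hI : I.IsHomogeneous (homogeneousSubmodule (Fin (n + 1)) K))
    {l : MvPolynomial (Fin (n + 1)) K} (hl : l.IsHomogeneous 1) {d : ℕ}
    (hinj : ∀ (f : MvPolynomial (Fin (n + 1)) K) (i : ℕ),
      f.IsHomogeneous d → f * l ^ i ∈ I → f ∈ I)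
    (hsurj : ∀ i, Function.Surjective (gradedMulPow I hl d i)) :
    Function.Bijective (dehomogenize I l d) := by
  constructor
  · rw [injective_iff_map_eq_zero]
    rintro ⟨a, ha⟩ h
    obtain ⟨f, hf, rfl⟩ := exists_of_mem_gradedPiece ha
    obtain ⟨i, hi⟩ := exists_mul_pow_mem_of_mk_eq_zero hI hl hf h
    exact Subtype.ext (Ideal.Quotient.eq_zero_iff_mem.2 (hinj f i hf hi))
  · rw [← LinearMap.range_eq_top, eq_top_iff]
    rintro x -
    obtain ⟨a, rfl⟩ := Ideal.Quotient.mk_surjective x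
    obtain ⟨p, rfl⟩ := Ideal.Quotient.mk_surjective a
    rw [← sum_homogeneousComponent p, map_sum, map_sum]
    refine Submodule.sum_mem _ fun k _ => ?_
    have hp := homogeneousComponent_isHomogeneous k p
    generalize homogeneousComponent k p = q at hp
    rcases le_total k d with hk | hk
    · have hq : (q * l ^ (d - k)).IsHomogeneous d := by
        have := hp.mul (hl.pow (d - k))
        rwa [one_mul, Nat.add_sub_cancel' hk] at this
      refine ⟨⟨_, mk_mem_gradedPiece hq⟩, ?_⟩
      have h := affineRing_mk_mul_pow l (Ideal.Quotient.mk I q) (d - k)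
      rwa [← map_pow, ← map_mul] at h
    · obtain ⟨i, rfl⟩ := Nat.exists_eq_add_of_le hk
      obtain ⟨b, hb⟩ := hsurj i ⟨_, mk_mem_gradedPiece hp⟩
      refine ⟨b, ?_⟩
      have hb' : (b : MvPolynomial (Fin (n + 1)) K ⧸ I) * Ideal.Quotient.mk I l ^ i =
          Ideal.Quotient.mk I q := by
        rw [← coe_gradedMulPow hl, hb]
      rw [← hb', dehomogenize_apply, affineRing_mk_mul_pow]

theorem rowMatrix_eq_of_comm {V W V' W' : Type*} [AddCommGroup V] [Module K V] [AddCommGroup W]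
    [Module K W] [AddCommGroup V'] [Module K V'] [AddCommGroup W'] [Module K W'] {p q : ℕ}
    (b : Module.Basis (Fin p) K V) (c : Module.Basis (Fin q) K W)
    (b' : Module.Basis (Fin p) K V') (c' : Module.Basis (Fin q) K W')
    {φ : V →ₗ[K] W} {φ' : V' →ₗ[K] W'} (α : V →ₗ[K] V') (β : W →ₗ[K] W')
    (hα : ∀ j, α (b j) = b' j) (hβ : ∀ j, β (c j) = c' j) (h : ∀ v, β (φ v) = φ' (α v)) :
    rowMatrix b c φ = rowMatrix b' c' φ' := by
  have hrepr : ∀ w, c'.repr (β w) = c.repr w := by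
    have : c'.repr.toLinearMap ∘ₗ β = c.repr.toLinearMap :=
      c.ext fun j => by simp [hβ]
    exact LinearMap.congr_fun this
  ext i j
  simp only [rowMatrix, Matrix.of_apply]
  rw [← hα, ← h, hrepr]

end Bases

end ProjMult

theorem mainTheorem4 {K : Type*} [Field K] {n : ℕ}
    (I : Ideal (MvPolynomial (Fin (n + 1)) K)) (hI : ProjMult.IsProjDimZero I)
    (t : Finset (Ideal (MvPolynomial (Fin (n + 1)) K)))
    (ht : Submodule.IsMinimalPrimaryDecomposition I t)
    (l : MvPolynomial (Fin (n + 1)) K) (hl : l.IsHomogeneous 1)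
    (hnzd : Ideal.Quotient.mk (ProjMult.unmixedPart t) l ∈
      nonZeroDivisors (MvPolynomial (Fin (n + 1)) K ⧸ ProjMult.unmixedPart t))
    (d : ℕ) (hd : ProjMult.nz I t ≤ d) {m : ℕ}
    (e : Module.Basis (Fin m) K (ProjMult.gradedPiece I d)) :
    m = Module.finrank K (ProjMult.gradedPiece I (ProjMult.nz I t)) ∧
    ∃ (B : ∀ i : ℕ, Module.Basis (Fin m) K (ProjMult.gradedPiece I (d + i)))
      (C : Module.Basis (Fin m) K (ProjMult.AffineRing I l)),
      (∀ i j, (B i j : MvPolynomial (Fin (n + 1)) K ⧸ I) =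
        (e j : MvPolynomial (Fin (n + 1)) K ⧸ I) * Ideal.Quotient.mk I l ^ i) ∧
      (∀ j, C j = Ideal.Quotient.mk _ (e j : MvPolynomial (Fin (n + 1)) K ⧸ I)) ∧
      (∃ σ : MvPolynomial (Fin (n + 1)) K ≃ₐ[K] MvPolynomial (Fin (n + 1)) K,
        ProjMult.IsLinearChange σ ∧ σ (MvPolynomial.X 0) = l) ∧
      ∀ (σ : MvPolynomial (Fin (n + 1)) K ≃ₐ[K] MvPolynomial (Fin (n + 1)) K)
        (hσ : ProjMult.IsLinearChange σ), σ (MvPolynomial.X 0) = l →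
        ∀ (k : Fin (n + 1)) (i : ℕ),
          ProjMult.projMulMatrix I (hσ k) (d + i) (B i) (B (i + 1)) =
            ProjMult.mulMatrix C
              (Ideal.Quotient.mk _ (Ideal.Quotient.mk I (σ (MvPolynomial.X k)))) := by
  have hinf := ht.inf_eq
  obtain ⟨m', hm', H⟩ := ProjMult.exists_finrank_and_mem_of_nz_le hI hinf
  have hm : m = m' := by
    rw [← (H d hd).1, Module.finrank_eq_card_basis e, Fintype.card_fin]
  have hinj : ∀ (f : MvPolynomial (Fin (n + 1)) K) (i : ℕ),
      f.IsHomogeneous d → f * l ^ i ∈ I → f ∈ I := fun f i hf =>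
    ProjMult.mem_of_mul_pow_mem hinf hnzd ((H d hd).2 f hf)
  have hbij : ∀ i, Function.Bijective (ProjMult.gradedMulPow I hl d i) := fun i =>
    ProjMult.gradedMulPow_bijective hl (fun f => hinj f i) ((H d hd).1 ▸ hm')
      ((H (d + i) (hd.trans (Nat.le_add_right d i))).1.trans (H d hd).1.symm)
  have hdeh := ProjMult.dehomogenize_bijective hI.1 hl hinj fun i => (hbij i).2
  have hB : ∀ i j, (e.map (LinearEquiv.ofBijective _ (hbij i)) j :
      MvPolynomial (Fin (n + 1)) K ⧸ I) = e j * Ideal.Quotient.mk I l ^ i := fun i j => by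
    rw [Module.Basis.map_apply, LinearEquiv.ofBijective_apply, ProjMult.coe_gradedMulPow]
  have hC : ∀ j, e.map (LinearEquiv.ofBijective _ hdeh) j =
      Ideal.Quotient.mk _ (e j : MvPolynomial (Fin (n + 1)) K ⧸ I) := fun j => by
    rw [Module.Basis.map_apply, LinearEquiv.ofBijective_apply, ProjMult.dehomogenize_apply]
  have hBC : ∀ i j, ProjMult.dehomogenize I l (d + i)
      (e.map (LinearEquiv.ofBijective _ (hbij i)) j) =
        e.map (LinearEquiv.ofBijective _ hdeh) j := fun i j => by
    rw [ProjMult.dehomogenize_apply, hB, hC, ProjMult.affineRing_mk_mul_pow]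
  refine ⟨hm.trans (H _ le_rfl).1.symm, fun i => e.map (LinearEquiv.ofBijective _ (hbij i)),
    e.map (LinearEquiv.ofBijective _ hdeh), hB, hC,
    ProjMult.exists_isLinearChange hl (ProjMult.ne_zero_of_mem_nonZeroDivisors hI hinf hnzd),
    fun σ hσ _ k i => ?_⟩
  exact ProjMult.rowMatrix_eq_of_comm _ _ _ _ (ProjMult.dehomogenize I l (d + i))
    -- The square commutes because `R → R_*` is a ring homomorphism.
    (ProjMult.dehomogenize I l (d + (i + 1))) (hBC i) (hBC (i + 1)) fun v => by
      rw [ProjMult.dehomogenize_apply, LinearMap.mulLeft_apply, ProjMult.dehomogenize_apply,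
        ← map_mul]
      rfl
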